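/- Let $K$ be a field, $\mathcal R=K\langle x_1,\dots,x_n\rangle$ the noncommutative polynomial ring, and $M$ its monoid of monomials (words). A \emph{term} is a nonzero scalar times a monomial. An \emph{admissible} monomial ordering is a strict total order on $M$ with $1<m$ for all $m\ne1$ and $m_1<m_2\Rightarrow um_1v<um_2v$. A finite set $G$ of nonzero polynomials is a \emph{Gröbner basis} of a two-sided ideal $J$ for such an ordering if $G$ generates $J$ and every S-polynomial $\mathrm{LC}(p_2)\,\ell_1p_1r_1-\mathrm{LC}(p_1)\,\ell_2p_2r_2$ with $p_1,p_2\in G$, formed from an overlap $\ell_1\mathrm{LM}(p_1)r_1=\ell_2\mathrm{LM}(p_2)r_2$ of the lead monomials, reduces to zero using $G$. An \emph{ordering function} is a map $\theta:M\to\mathbb Z$. A sequence $(\theta_1,\theta_2,\dots)$ of ordering functions \emph{defines} an ordering if $m_1<m_2$ implies that $\theta_i(m_1)<\theta_i(m_2)$ for some $i$ with $\theta_j(m_1)=\theta_j(m_2)$ for all $j<i$. The \emph{initial} $\mathrm{in}_\theta(p)$ is the sum of the terms of $p$ of maximal $\theta$-value; $p$ is \emph{$\theta$-homogeneous} if $p=\mathrm{in}_\theta(p)$;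 $\theta$ is \emph{extendible} if $upv$ is $\theta$-homogeneous for every $\theta$-homogeneous $p$ and all terms $u,v$. Let $\mathrm{in}_\theta(J)$ be the two-sided ideal generated by $\{\mathrm{in}_\theta(p):p\in J\}$. Let $O$ and $O'$ be admissible monomial orderings that are harmonious, i.e. defined by sequences of ordering functions with the same first member $\theta$, which is extendible. Assume moreover that multiplication preserves strict inequalities of $\theta$-values: $\theta(m_1)<\theta(m_2)\Rightarrow\theta(um_1v)<\theta(um_2v)$ for all monomials $m_1,m_2,u,v$ (as it does for the degree function). Let $G$ be a Gröbner basis of a two-sided ideal $J$ of $\mathcal R$ with respect to $O$, and let $G'=\{\mathrm{in}_\theta(g):g\in G\}$. Then: (1) $G'$ is a Gröbner basis of $\mathrm{in}_\theta(J)$ with respect to $O$. (2) Let $H'$ be a Gröbner basis (for instance the reduced one) of the ideal $\langle G'\rangle$ with respect to $O'$. Then every $h'\in H'$ has a logged representation $h'=\sum_i\ell_i\,\mathrm{in}_\theta(g_i)\,r_i$, with $g_i\in G$ and terms $\ell_i,r_i$, of one of the following two kinds: it is recorded in a logged Gröbner basis computation (Mora's algorithm, with reduction of the basis) started from $G'$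 with respect to $O'$, or it is recorded by dividing $h'$ by $G'$, using $O$ or $O'$, with remainder $0$. For every choice of one logged representation of these kinds for each $h'\in H'$, the set $H$ of the lifted polynomials $\sum_i\ell_i\,g_i\,r_i$ is a Gröbner basis of $J$ with respect to $O'$. -/

import Mathlib

namespace NCWalk

/-- Monomials in the noncommuting variables `x_1, …, x_n`: words, multiplied by concatenation. -/
abbrev Monomial (n : ℕ) := FreeMonoid (Fin n)

/-- The noncommutative polynomial ring `K⟨x_1, …, x_n⟩`. -/
abbrev Poly (K : Type*) [Field K] (n : ℕ) := MonoidAlgebra K (Monomial n)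

/-- An admissible monomial ordering: a strict total order on the monomials for which `1` is the
least monomial and which is preserved by two-sided multiplication by monomials. -/
structure AdmissibleOrder (n : ℕ) where
  lt : Monomial n → Monomial n → Prop
  irrefl : ∀ m, ¬ lt m m
  trans : ∀ m₁ m₂ m₃, lt m₁ m₂ → lt m₂ m₃ → lt m₁ m₃
  total : ∀ m₁ m₂, m₁ ≠ m₂ → lt m₁ m₂ ∨ lt m₂ m₁
  one_lt : ∀ m, m ≠ 1 → lt 1 m
  mul_lt : ∀ l r m₁ m₂, lt m₁ m₂ → lt (l * m₁ * r) (l * m₂ * r)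

/-! ### Ordering functions and functional decompositions -/

/-- An ordering function assigns an integer to each monomial. -/
abbrev OrderingFunction (n : ℕ) := Monomial n → ℤ

/-- The sequence `Θ 0, Θ 1, …` of ordering functions defines the ordering `O`: whenever `m₁ < m₂`,
the first function that separates them is smaller at `m₁`. (A finite sequence can be continued by
constant functions.) -/
def Defines {n : ℕ} (Θ : ℕ → OrderingFunction n) (O : AdmissibleOrder n) : Prop :=
  ∀ m₁ m₂, O.lt m₁ m₂ → ∃ i, Θ i m₁ < Θ i m₂ ∧ ∀ j < i, Θ j m₁ = Θ j m₂

section Polynomials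

variable {K : Type*} [Field K] {n : ℕ}

/-- The product `(c ℓ) p r` for a scalar `c` and monomials `ℓ`, `r`. -/
noncomputable def multiple (c : K) (l : Monomial n) (p : Poly K n) (r : Monomial n) : Poly K n :=
  MonoidAlgebra.single l c * p * MonoidAlgebra.single r 1

open Classical in
/-- The initial `in_θ(p)`: the sum of the terms of `p` of maximal `θ`-value. -/
noncomputable def initial (θ : OrderingFunction n) (p : Poly K n) : Poly K n :=
  MonoidAlgebra.ofCoeff
    (p.coeff.filter fun m => ∀ m' ∈ p.coeff.support, θ m' ≤ θ m)

/-- `p` is `θ`-homogeneous if it equals its initial. -/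
def IsHomogeneous (θ : OrderingFunction n) (p : Poly K n) : Prop :=
  p = initial θ p

/-- `θ` is extendible: multiples `u p v` of `θ`-homogeneous polynomials by terms `u = a s`,
`v = b t` are `θ`-homogeneous. -/
def IsExtendible (K : Type*) [Field K] {n : ℕ} (θ : OrderingFunction n) : Prop :=
  ∀ p : Poly K n, IsHomogeneous θ p → ∀ (s t : Monomial n) (a b : K), a ≠ 0 → b ≠ 0 →
    IsHomogeneous θ (MonoidAlgebra.single s a * p * MonoidAlgebra.single t b)

/-- Multiplication by monomials preserves strict inequality of `θ`-values, so that a term outside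
the initial of `p` stays outside the initial of every multiple of `p` by terms. -/
def PreservesStrict (θ : OrderingFunction n) : Prop :=
  ∀ u v m₁ m₂, θ m₁ < θ m₂ → θ (u * m₁ * v) < θ (u * m₂ * v)

/-- `O₁` and `O₂` are harmonious by means of the functional decompositions `Θ₁`, `Θ₂`: these define
`O₁` and `O₂`, and their first ordering functions are identical and extendible. -/
structure AreHarmonious (K : Type*) [Field K] {n : ℕ} (O₁ O₂ : AdmissibleOrder n)
    (Θ₁ Θ₂ : ℕ → OrderingFunction n) : Prop where
  defines_left : Defines Θ₁ O₁
  defines_right : Defines Θ₂ O₂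
  first_eq : Θ₁ 0 = Θ₂ 0
  extendible : IsExtendible K (Θ₁ 0)

/-! ### Division, S-polynomials and Gröbner bases -/

/-- `m` is the lead monomial of `p` (in particular `p ≠ 0`). -/
def IsLeadMon (O : AdmissibleOrder n) (p : Poly K n) (m : Monomial n) : Prop :=
  m ∈ p.coeff.support ∧ ∀ m' ∈ p.coeff.support, m' ≠ m → O.lt m' m

/-- One division step `p →_q p'`: the lead monomial `w` of `q` divides a monomial `ℓ w r` of `p`,
and the term of `p` at `ℓ w r` is cancelled by a multiple of `q`. -/
def DividesTo (O : AdmissibleOrder n) (q p p' : Poly K n) : Prop :=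
  ∃ w l r, IsLeadMon O q w ∧ l * w * r ∈ p.coeff.support ∧
    p' = p - multiple (p.coeff (l * w * r) * (q.coeff w)⁻¹) l q r

/-- `p` reduces to `p'` using the set `P`: a finite sequence of division steps by members
of `P`. -/
def ReducesTo (O : AdmissibleOrder n) (P : Set (Poly K n)) (p p' : Poly K n) : Prop :=
  Relation.ReflTransGen (fun a b => ∃ q ∈ P, DividesTo O q a b) p p'

/-- `ℓ₁ m₁ r₁ = ℓ₂ m₂ r₂` is an overlap of `m₁` and `m₂`: at least one of `ℓ₁`, `ℓ₂` and at least
one of `r₁`, `r₂` is the unit monomial, and the two subwords share a letter position. -/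
structure IsOverlap (m₁ m₂ l₁ r₁ l₂ r₂ : Monomial n) : Prop where
  word_eq : l₁ * m₁ * r₁ = l₂ * m₂ * r₂
  left_one : l₁ = 1 ∨ l₂ = 1
  right_one : r₁ = 1 ∨ r₂ = 1
  shared : ∃ i : ℕ, l₁.length ≤ i ∧ i < l₁.length + m₁.length ∧
    l₂.length ≤ i ∧ i < l₂.length + m₂.length

/-- `s` is an S-polynomial of `p₁` and `p₂`:
`s = LC(p₂) ℓ₁ p₁ r₁ - LC(p₁) ℓ₂ p₂ r₂` for an overlap of their lead monomials. -/
def IsSPoly (O : AdmissibleOrder n) (p₁ p₂ s : Poly K n) : Prop :=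
  ∃ m₁ m₂ l₁ r₁ l₂ r₂, IsLeadMon O p₁ m₁ ∧ IsLeadMon O p₂ m₂ ∧ IsOverlap m₁ m₂ l₁ r₁ l₂ r₂ ∧
    s = multiple (p₂.coeff m₂) l₁ p₁ r₁ - multiple (p₁.coeff m₁) l₂ p₂ r₂

/-- `G` is a (finite) noncommutative Gröbner basis for the two-sided ideal `J` with respect
to `O`. -/
structure IsGroebnerBasis (O : AdmissibleOrder n) (J : TwoSidedIdeal (Poly K n))
    (G : Set (Poly K n)) : Prop where
  finite : G.Finite
  ne_zero : ∀ g ∈ G, g ≠ 0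
  span_eq : TwoSidedIdeal.span G = J
  spoly_reduces : ∀ p₁ ∈ G, ∀ p₂ ∈ G, ∀ s, IsSPoly O p₁ p₂ s → ReducesTo O G s 0

/-- The ideal `in_θ(J)` generated by the initials of the members of `J`. -/
noncomputable def initialIdeal (θ : OrderingFunction n) (J : TwoSidedIdeal (Poly K n)) :
    TwoSidedIdeal (Poly K n) :=
  TwoSidedIdeal.span {q | ∃ p ∈ J, q = initial θ p}

/-! ### Logged representations with respect to the initials -/

/-- A summand `c ℓ · r` of a logged representation, together with the member `poly` of `G` whose
initial it refers to. -/
structure LogEntry (K : Type*) [Field K] (n : ℕ) where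
  coeff : K
  left : Monomial n
  poly : Poly K n
  right : Monomial n

/-- A formal sum `∑ ℓ_i g_i r_i`. -/
abbrev Log (K : Type*) [Field K] (n : ℕ) := List (LogEntry K n)

/-- The value `∑ ℓ_i in_θ(g_i) r_i`. -/
noncomputable def initialSum (θ : OrderingFunction n) (L : Log K n) : Poly K n :=
  (L.map fun e => multiple e.coeff e.left (initial θ e.poly) e.right).sum

/-- The lifted value `∑ ℓ_i g_i r_i`. -/
noncomputable def liftSum (L : Log K n) : Poly K n :=
  (L.map fun e => multiple e.coeff e.left e.poly e.right).sum

/-- The formal product `(c ℓ) L r`. -/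
def Log.multiple (c : K) (l : Monomial n) (L : Log K n) (r : Monomial n) : Log K n :=
  L.map fun e => ⟨c * e.coeff, l * e.left, e.poly, e.right * r⟩

/-- The polynomials that can occur, together with the logs recorded for them, in a logged
Gröbner basis computation with respect to `O` (Mora's algorithm followed by reduction of the
basis) started from `{in_θ(g) | g ∈ G}`: the input with its trivial logs, and whatever is obtained
by forming S-polynomials, by division steps and by division by the lead coefficient. -/
inductive MoraLog (O : AdmissibleOrder n) (θ : OrderingFunction n) (G : Set (Poly K n)) :
    Poly K n → Log K n → Prop
  | input (g : Poly K n) (hg : g ∈ G) : MoraLog O θ G (initial θ g) [⟨1, 1, g, 1⟩]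
  | spoly (p₁ p₂ : Poly K n) (L₁ L₂ : Log K n) (m₁ m₂ l₁ r₁ l₂ r₂ : Monomial n)
      (h₁ : MoraLog O θ G p₁ L₁) (h₂ : MoraLog O θ G p₂ L₂)
      (hm₁ : IsLeadMon O p₁ m₁) (hm₂ : IsLeadMon O p₂ m₂) (ho : IsOverlap m₁ m₂ l₁ r₁ l₂ r₂) :
      MoraLog O θ G
        (multiple (p₂.coeff m₂) l₁ p₁ r₁ - multiple (p₁.coeff m₁) l₂ p₂ r₂)
        (Log.multiple (p₂.coeff m₂) l₁ L₁ r₁ ++ Log.multiple (-(p₁.coeff m₁)) l₂ L₂ r₂)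
  | divide (p q : Poly K n) (L M : Log K n) (w l r : Monomial n)
      (hp : MoraLog O θ G p L) (hq : MoraLog O θ G q M)
      (hw : IsLeadMon O q w) (hm : l * w * r ∈ p.coeff.support) :
      MoraLog O θ G
        (p - multiple (p.coeff (l * w * r) * (q.coeff w)⁻¹) l q r)
        (L ++ Log.multiple (-(p.coeff (l * w * r) * (q.coeff w)⁻¹)) l M r)
  | normalise (p : Poly K n) (L : Log K n) (w : Monomial n)
      (hp : MoraLog O θ G p L) (hw : IsLeadMon O p w) :
      MoraLog O θ G (multiple (p.coeff w)⁻¹ 1 p 1) (Log.multiple (p.coeff w)⁻¹ 1 L 1)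

/-- `DivisionLog O θ G p L`: dividing `p` with respect to `{in_θ(g) | g ∈ G}` by means of `O` can
end with remainder `0`, the multiples subtracted on the way being recorded in `L`. -/
inductive DivisionLog (O : AdmissibleOrder n) (θ : OrderingFunction n) (G : Set (Poly K n)) :
    Poly K n → Log K n → Prop
  | zero : DivisionLog O θ G 0 []
  | step (p g : Poly K n) (L : Log K n) (w l r : Monomial n) (hg : g ∈ G)
      (hw : IsLeadMon O (initial θ g) w) (hm : l * w * r ∈ p.coeff.support)
      (hL : DivisionLog O θ G
        (p - multiple (p.coeff (l * w * r) * ((initial θ g).coeff w)⁻¹) l (initial θ g) r) L) :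
      DivisionLog O θ G p
        (⟨p.coeff (l * w * r) * ((initial θ g).coeff w)⁻¹, l, g, r⟩ :: L)

/-- `L` is a logged representation `h' = ∑ ℓ_i in_θ(g_i) r_i` (`g_i ∈ G`) as used by the walk from
`O` to `O'`: obtained from a logged Gröbner basis computation with respect to `O'`, or by dividing
`h'` with respect to the initials (by means of either ordering). -/
structure IsLoggedRepresentation (O O' : AdmissibleOrder n) (θ : OrderingFunction n)
    (G : Set (Poly K n)) (h' : Poly K n) (L : Log K n) : Prop where
  mem : ∀ e ∈ L, e.poly ∈ G
  sum_eq : initialSum θ L = h'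
  computed : MoraLog O' θ G h' L ∨ DivisionLog O θ G h' L ∨ DivisionLog O' θ G h' L

end Polynomials

end NCWalk

/-! Everything rests on lead monomials. Since `θ` comes first in both orderings, it is weakly
monotone for each of them, so `p` and its initial have the same lead monomial for `O` and for `O'`.

The Gröbner property defined through S-polynomials is equivalent to this: the lead monomial of each
nonzero member of the ideal is divisible by one from the basis
(`IsGroebnerBasis.exists_isLeadMon_dvd`, `isGroebnerBasis_of_lead`). The hard direction is
Buchberger's argument: two multiples with the same top word, made monic, differ by a combination of
smaller multiples, so cancellation at the top can be pushed down. This descent ends because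
admissible orderings are well-founded (Higman).

Part (1) follows because every lead monomial of `in_θ(J)` is a lead monomial of `J`: by
extendibility and strictness, the part of top `θ`-value of a member of `in_θ(J)` is also the part of
that value of a member of `J` without larger values.

For part (2), division by the Gröbner basis of initials for `O` provides the logs. Neither kind of
log contains a summand whose `θ`-value exceeds that of the lead monomial of `h'`. Replacing
`in_θ(g)` by `g` then adds only terms of strictly smaller `θ`-value, so lifting keeps the `O'`-lead
monomial. For `f` in `J`, the initial of `f` lies in `in_θ(J)` and has the same lead monomial, which
is divisible by that of some `h'`, hence by that of its lift. -/

namespace NCWalk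

/-! ### Admissible orderings are well-orderings -/

namespace AdmissibleOrder

variable {n : ℕ} (O : AdmissibleOrder n)

/-- The non-strict relation of an admissible ordering. -/
def le (m₁ m₂ : Monomial n) : Prop := m₁ = m₂ ∨ O.lt m₁ m₂

variable {O}

theorem le_refl (m : Monomial n) : O.le m m := Or.inl rfl

theorem lt_of_le_of_lt {a b c : Monomial n} (h : O.le a b) (h' : O.lt b c) : O.lt a c := by
  rcases h with rfl | h
  · exact h'
  · exact O.trans _ _ _ h h'

theorem lt_of_lt_of_le {a b c : Monomial n} (h : O.lt a b) (h' : O.le b c) : O.lt a c := by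
  rcases h' with rfl | h'
  · exact h
  · exact O.trans _ _ _ h h'

theorem le_trans {a b c : Monomial n} (h : O.le a b) (h' : O.le b c) : O.le a c := by
  rcases h with rfl | h
  · exact h'
  · exact Or.inr (lt_of_lt_of_le h h')

theorem le_total (a b : Monomial n) : O.le a b ∨ O.lt b a := by
  by_cases h : a = b
  · exact Or.inl (Or.inl h)
  · exact (O.total a b h).imp Or.inr id

theorem mul_le (l r : Monomial n) {a b : Monomial n} (h : O.le a b) :
    O.le (l * a * r) (l * b * r) := by
  rcases h with rfl | h
  · exact le_refl _
  · exact Or.inr (O.mul_lt _ _ _ _ h)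

theorem lt_of_le_of_ne {a b : Monomial n} (h : O.le a b) (h' : a ≠ b) : O.lt a b :=
  h.resolve_left h'

/-- Inserting a letter into a word never makes it smaller, because `1` is least and the ordering is
compatible with multiplication. This links the ordering to Higman's subword relation. -/
theorem le_of_sublistForall₂ {a b : List (Fin n)} (h : List.SublistForall₂ (· = ·) a b) :
    O.le (FreeMonoid.ofList a) (FreeMonoid.ofList b) := by
  induction h with
  | @nil l =>
    by_cases hl : FreeMonoid.ofList l = 1
    · exact Or.inl hl.symm
    · exact Or.inr (O.one_lt _ hl)
  | @cons a₁ a₂ l₁ l₂ h _ ih =>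
    subst h
    simpa [FreeMonoid.ofList_cons] using mul_le (FreeMonoid.of a₁) 1 ih
  | @cons_right a l₁ l₂ _ ih =>
    refine le_trans ih (Or.inr ?_)
    have := O.mul_lt 1 (FreeMonoid.ofList l₂) 1 (FreeMonoid.of a)
      (O.one_lt _ (FreeMonoid.of_ne_one a))
    simpa [FreeMonoid.ofList_cons] using this

/-- By Higman's lemma an admissible ordering is a well-ordering. -/
theorem wellFounded (O : AdmissibleOrder n) : WellFounded O.lt := by
  rw [wellFounded_iff_isEmpty_descending_chain]
  refine ⟨fun ⟨f, hf⟩ => ?_⟩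
  have hdesc : ∀ i j, i < j → O.lt (f j) (f i) := by
    intro i j hij
    induction hij with
    | refl => exact hf i
    | step _ ih => exact O.trans _ _ _ (hf _) ih
  -- The alphabet is finite, so equality of letters is already a well-quasi-order on it, as Higman's
  -- lemma requires.
  have hpwo : (Set.univ : Set (Fin n)).PartiallyWellOrderedOn (· = ·) :=
    (Set.toFinite _).partiallyWellOrderedOn
  obtain ⟨i, j, hij, h⟩ :=
    (Set.PartiallyWellOrderedOn.partiallyWellOrderedOn_sublistForall₂ _ hpwo).exists_lt
      (f := fun k => FreeMonoid.toList (f k)) (fun _ _ _ => Set.mem_univ _)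
  exact O.irrefl _ (lt_of_lt_of_le (hdesc i j hij) (le_of_sublistForall₂ h))

theorem exists_greatest (O : AdmissibleOrder n) {S : Finset (Monomial n)} (hS : S.Nonempty) :
    ∃ m ∈ S, ∀ m' ∈ S, O.le m' m := by
  induction hS using Finset.Nonempty.cons_induction with
  | singleton a => exact ⟨a, by simp, by simp [le_refl]⟩
  | cons a s ha hs ih =>
    obtain ⟨m, hm, hmax⟩ := ih
    rcases O.le_total a m with h | h
    · refine ⟨m, by simp [hm], fun m' hm' => ?_⟩
      rcases Finset.mem_cons.1 hm' with rfl | hm'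
      · exact h
      · exact hmax _ hm'
    · refine ⟨a, by simp, fun m' hm' => ?_⟩
      rcases Finset.mem_cons.1 hm' with rfl | hm'
      · exact le_refl _
      · exact le_trans (hmax _ hm') (Or.inr h)

end AdmissibleOrder

/-! ### Multiples of a polynomial by terms -/

section Multiples

variable {K : Type*} [Field K] {n : ℕ}

theorem coeff_multiple (c : K) (l : Monomial n) (p : Poly K n) (r m : Monomial n) :
    (multiple c l p r).coeff (l * m * r) = c * p.coeff m := by
  simp [multiple]

theorem exists_of_mem_support_multiple {c : K} {l r m' : Monomial n} {p : Poly K n}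
    (h : m' ∈ (multiple c l p r).coeff.support) : ∃ m ∈ p.coeff.support, m' = l * m * r := by
  rw [Finsupp.mem_support_iff] at h
  have : ∃ m, m' = l * m * r := by
    by_contra! hne
    apply h
    by_cases hr : ∃ d, d * r = m'
    · obtain ⟨d, rfl⟩ := hr
      rw [multiple, MonoidAlgebra.coeff_mul_single_mul,
        MonoidAlgebra.coeff_single_mul_of_forall_mul_ne, zero_mul]
      intro e he
      exact hne e (by rw [he])
    · push Not at hr
      rw [multiple, MonoidAlgebra.coeff_mul_single_of_forall_mul_ne _ _ hr]
  obtain ⟨m, rfl⟩ := this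
  refine ⟨m, ?_, rfl⟩
  rw [coeff_multiple] at h
  exact Finsupp.mem_support_iff.2 (right_ne_zero_of_mul h)

theorem multiple_add (c : K) (l r : Monomial n) (p q : Poly K n) :
    multiple c l (p + q) r = multiple c l p r + multiple c l q r := by
  simp [multiple, mul_add, add_mul]

theorem multiple_sub (c : K) (l r : Monomial n) (p q : Poly K n) :
    multiple c l (p - q) r = multiple c l p r - multiple c l q r := by
  simp [multiple, mul_sub, sub_mul]

@[simp]
theorem multiple_zero (c : K) (l r : Monomial n) : multiple c l (0 : Poly K n) r = 0 := by
  simp [multiple]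

theorem multiple_eq_smul (c : K) (l r : Monomial n) (p : Poly K n) :
    multiple c l p r = c • multiple 1 l p r := by
  have : (MonoidAlgebra.single l c : Poly K n) = c • MonoidAlgebra.single l 1 := by simp
  rw [multiple, multiple, this, smul_mul_assoc, smul_mul_assoc]

theorem multiple_smul (c d : K) (l r : Monomial n) (p : Poly K n) :
    multiple c l (d • p) r = d • multiple c l p r := by
  simp [multiple]

theorem multiple_multiple (c c' : K) (l l' r r' : Monomial n) (p : Poly K n) :
    multiple c l (multiple c' l' p r') r = multiple (c * c') (l * l') p (r' * r) := by
  have hl : (MonoidAlgebra.single (l * l') (c * c') : Poly K n) =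
      MonoidAlgebra.single l c * MonoidAlgebra.single l' c' := by
    rw [MonoidAlgebra.single_mul_single]
  have hr : (MonoidAlgebra.single (r' * r) 1 : Poly K n) =
      MonoidAlgebra.single r' 1 * MonoidAlgebra.single r 1 := by
    rw [MonoidAlgebra.single_mul_single, one_mul]
  simp only [multiple, hl, hr, mul_assoc]

theorem multiple_mem {J : TwoSidedIdeal (Poly K n)} {p : Poly K n} (hp : p ∈ J) (c : K)
    (l r : Monomial n) : multiple c l p r ∈ J :=
  J.mul_mem_right _ _ (J.mul_mem_left _ _ hp)

/-- The two-sided ideal generated by `S` is contained in the `K`-span of the multiples of the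
members of `S` by monomials. -/
theorem mem_submodule_of_mem_span {S : Set (Poly K n)} {V : Submodule K (Poly K n)}
    (hV : ∀ s ∈ S, ∀ l r, multiple 1 l s r ∈ V) {f : Poly K n}
    (hf : f ∈ TwoSidedIdeal.span S) : f ∈ V := by
  rw [TwoSidedIdeal.mem_span_iff_mem_addSubgroup_closure] at hf
  refine (AddSubgroup.closure_le V.toAddSubgroup).2 ?_ hf
  rintro _ ⟨_, ⟨a, -, s, hs, rfl⟩, b, -, rfl⟩
  change a * s * b ∈ V
  induction a using MonoidAlgebra.induction_linear with
  | zero => simp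
  | add x y hx hy => rw [add_mul, add_mul]; exact V.add_mem hx hy
  | single l c =>
    induction b using MonoidAlgebra.induction_linear with
    | zero => simp
    | add x y hx hy => rw [mul_add]; exact V.add_mem hx hy
    | single r d =>
      have h := V.smul_mem (c * d) (hV s hs l r)
      have hl : (MonoidAlgebra.single l c : Poly K n) = c • MonoidAlgebra.single l 1 := by simp
      have hr : (MonoidAlgebra.single r d : Poly K n) = d • MonoidAlgebra.single r 1 := by simp
      rw [hl, hr, smul_mul_assoc, smul_mul_assoc, mul_smul_comm, smul_smul]
      exact h

end Multiples

/-! ### Lead monomials and supports -/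

section LeadMonomials

variable {K : Type*} [Field K] {n : ℕ} {O : AdmissibleOrder n}

theorem exists_isLeadMon (O : AdmissibleOrder n) {p : Poly K n} (hp : p ≠ 0) :
    ∃ m, IsLeadMon O p m := by
  have : p.coeff.support.Nonempty := by simpa [Finsupp.support_nonempty_iff] using hp
  obtain ⟨m, hm, hmax⟩ := O.exists_greatest this
  exact ⟨m, hm, fun m' hm' hne => (hmax m' hm').resolve_left hne⟩

theorem IsLeadMon.le {p : Poly K n} {m m' : Monomial n} (h : IsLeadMon O p m)
    (hm' : m' ∈ p.coeff.support) : O.le m' m := by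
  by_cases hne : m' = m
  · exact Or.inl hne
  · exact Or.inr (h.2 m' hm' hne)

theorem IsLeadMon.ne_zero {p : Poly K n} {m : Monomial n} (h : IsLeadMon O p m) : p ≠ 0 := by
  rintro rfl
  simpa using h.1

theorem IsLeadMon.coeff_ne_zero {p : Poly K n} {m : Monomial n} (h : IsLeadMon O p m) :
    p.coeff m ≠ 0 :=
  Finsupp.mem_support_iff.1 h.1

theorem mem_support_or_of_sub {p q : Poly K n} {m : Monomial n}
    (h : m ∈ (p - q).coeff.support) : m ∈ p.coeff.support ∨ m ∈ q.coeff.support := by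
  by_contra! hne
  simp only [Finsupp.mem_support_iff, not_not] at hne h
  apply h
  change (p.coeff - q.coeff) m = 0
  simp [hne.1, hne.2]

theorem mem_support_or_of_add {p q : Poly K n} {m : Monomial n}
    (h : m ∈ (p + q).coeff.support) : m ∈ p.coeff.support ∨ m ∈ q.coeff.support := by
  by_contra! hne
  simp only [Finsupp.mem_support_iff, not_not] at hne h
  apply h
  simp [hne.1, hne.2]

end LeadMonomials

/-! ### Buchberger's criterion for words -/

section Buchberger

variable {K : Type*} [Field K] {n : ℕ} {O : AdmissibleOrder n} {G : Set (Poly K n)}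

/-- The span of the multiples `ℓ g r` (`g ∈ G`) whose lead monomial satisfies `P`. -/
noncomputable def multiplesSpan (O : AdmissibleOrder n) (G : Set (Poly K n)) (P : Monomial n → Prop) :
    Submodule K (Poly K n) :=
  Submodule.span K {q | ∃ g ∈ G, ∃ w l r, IsLeadMon O g w ∧ P (l * w * r) ∧ q = multiple 1 l g r}

theorem multiple_mem_multiplesSpan {P : Monomial n → Prop} {g : Poly K n} (hg : g ∈ G)
    {w l r : Monomial n} (hw : IsLeadMon O g w) (hP : P (l * w * r)) (c : K) :
    multiple c l g r ∈ multiplesSpan O G P := by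
  rw [multiple_eq_smul]
  exact Submodule.smul_mem _ _ (Submodule.subset_span ⟨g, hg, w, l, r, hw, hP, rfl⟩)

theorem multiplesSpan_mono {P Q : Monomial n → Prop} (h : ∀ m, P m → Q m) :
    multiplesSpan O G P ≤ multiplesSpan O G Q := by
  refine Submodule.span_mono ?_
  rintro _ ⟨g, hg, w, l, r, hw, hP, rfl⟩
  exact ⟨g, hg, w, l, r, hw, h _ hP, rfl⟩

theorem forall_support_of_mem_multiplesSpan {P : Monomial n → Prop}
    (hP : ∀ a b, O.lt a b → P b → P a) {f : Poly K n} (hf : f ∈ multiplesSpan O G P) :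
    ∀ m ∈ f.coeff.support, P m := by
  induction hf using Submodule.span_induction with
  | mem x hx =>
    obtain ⟨g, hg, w, l, r, hw, hlwr, rfl⟩ := hx
    intro m hm
    obtain ⟨t, ht, rfl⟩ := exists_of_mem_support_multiple hm
    rcases AdmissibleOrder.mul_le l r (hw.le ht) with h | h
    · rwa [h]
    · exact hP _ _ h hlwr
  | zero => simp
  | add x y _ _ hx hy => exact fun m hm => (mem_support_or_of_add hm).elim (hx m) (hy m)
  | smul c x _ hx => exact fun m hm => hx m (Finsupp.support_smul hm)

theorem multiple_mem_of_mem_multiplesSpan {P Q : Monomial n → Prop} (a b : Monomial n)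
    (h : ∀ t, P t → Q (a * t * b)) (c : K) {f : Poly K n} (hf : f ∈ multiplesSpan O G P) :
    multiple c a f b ∈ multiplesSpan O G Q := by
  induction hf using Submodule.span_induction with
  | mem x hx =>
    obtain ⟨g, hg, w, l, r, hw, hlwr, rfl⟩ := hx
    rw [multiple_multiple]
    refine multiple_mem_multiplesSpan hg hw ?_ _
    simpa only [mul_assoc] using h _ hlwr
  | zero => simp
  | add x y _ _ hx hy => rw [multiple_add]; exact Submodule.add_mem _ hx hy
  | smul d x _ hx => rw [multiple_smul]; exact Submodule.smul_mem _ _ hx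

/-- A nonzero member of a `multiplesSpan` is a combination of multiples bounded by one of the
monomials that are allowed. -/
theorem eq_zero_or_exists_le_of_mem_multiplesSpan {P : Monomial n → Prop} {f : Poly K n}
    (hf : f ∈ multiplesSpan O G P) : f = 0 ∨ ∃ m, P m ∧ f ∈ multiplesSpan O G (O.le · m) := by
  induction hf using Submodule.span_induction with
  | mem x hx =>
    obtain ⟨g, hg, w, l, r, hw, hlwr, rfl⟩ := hx
    exact Or.inr ⟨l * w * r, hlwr, multiple_mem_multiplesSpan (P := (O.le · (l * w * r))) hg hw
      (AdmissibleOrder.le_refl _) 1⟩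
  | zero => exact Or.inl rfl
  | add x y _ _ hx hy =>
    rcases hx with rfl | ⟨m, hm, hx⟩
    · simpa using hy
    rcases hy with rfl | ⟨m', hm', hy⟩
    · exact Or.inr ⟨m, hm, by simpa using hx⟩
    rcases O.le_total m m' with h | h
    · exact Or.inr ⟨m', hm', Submodule.add_mem _
        (multiplesSpan_mono (fun t ht => AdmissibleOrder.le_trans ht h) hx) hy⟩
    · exact Or.inr ⟨m, hm, Submodule.add_mem _ hx
        (multiplesSpan_mono (fun t ht => AdmissibleOrder.le_trans ht (Or.inr h)) hy)⟩
  | smul c x _ hx =>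
    rcases hx with rfl | ⟨m, hm, hx⟩
    · simp
    · exact Or.inr ⟨m, hm, Submodule.smul_mem _ _ hx⟩

/-- Each division step subtracts a multiple whose lead monomial occurs in the current polynomial.
For a downward closed `P` the bound therefore survives every step, and a reduction to zero is a
representation by bounded multiples. -/
theorem ReducesTo.mem_multiplesSpan {P : Monomial n → Prop}
    (hP : ∀ a b, O.lt a b → P b → P a) {p : Poly K n} (h : ReducesTo O G p 0)
    (hp : ∀ m ∈ p.coeff.support, P m) : p ∈ multiplesSpan O G P := by
  induction h using Relation.ReflTransGen.head_induction_on with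
  | refl => exact Submodule.zero_mem _
  | head hstep _ ih =>
    obtain ⟨q, hq, w, l, r, hw, hm, rfl⟩ := hstep
    have hmem := multiple_mem_multiplesSpan (P := P) hq hw (hp _ hm)
    rw [← Submodule.sub_mem_iff_left _ (hmem _)]
    exact ih fun m hm => (mem_support_or_of_sub hm).elim (hp m)
      (forall_support_of_mem_multiplesSpan hP (hmem _) m)

theorem mul_mem_of_forall_single {V : Submodule K (Poly K n)} {a q b : Poly K n}
    (h : ∀ t ∈ q.coeff.support, a * MonoidAlgebra.single t 1 * b ∈ V) : a * q * b ∈ V := by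
  have hq : q = ∑ t ∈ q.coeff.support, q.coeff t • MonoidAlgebra.single t (1 : K) := by
    conv_lhs => rw [← MonoidAlgebra.sum_coeff_single q]
    simp [Finsupp.sum]
  rw [hq, Finset.mul_sum, Finset.sum_mul]
  refine Submodule.sum_mem _ fun t ht => ?_
  rw [mul_smul_comm, smul_mul_assoc]
  exact V.smul_mem _ (h t ht)

theorem IsLeadMon.lt_of_mem_support_sub {g : Poly K n} {w t : Monomial n} (hw : IsLeadMon O g w)
    (ht : t ∈ (g - MonoidAlgebra.single w (g.coeff w)).coeff.support) : O.lt t w := by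
  have hne : t ≠ w := by
    rintro rfl
    rw [Finsupp.mem_support_iff] at ht
    apply ht
    change (g.coeff - Finsupp.single t (g.coeff t)) t = 0
    simp
  rcases mem_support_or_of_sub ht with h | h
  · exact hw.2 t h hne
  · have : t = w := by
      by_contra h'
      simp [Ne.symm h'] at h
    exact absurd this hne

/-- `c⁻¹ ℓ g r`, where `c` is the coefficient of `w` in `g`. -/
noncomputable def monicMultiple (w l : Monomial n) (g : Poly K n) (r : Monomial n) : Poly K n :=
  multiple (g.coeff w)⁻¹ l g r

/-- Multiples at disjoint positions of a word agree modulo smaller multiples. -/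
theorem monicMultiple_sub_mem_of_disjoint {g₁ g₂ : Poly K n} (hg₁ : g₁ ∈ G) (hg₂ : g₂ ∈ G)
    {w₁ w₂ : Monomial n} (hw₁ : IsLeadMon O g₁ w₁) (hw₂ : IsLeadMon O g₂ w₂)
    (l a r : Monomial n) :
    monicMultiple w₁ l g₁ (a * w₂ * r) - monicMultiple w₂ (l * w₁ * a) g₂ r ∈
      multiplesSpan O G (O.lt · (l * w₁ * a * w₂ * r)) := by
  set V := multiplesSpan O G (O.lt · (l * w₁ * a * w₂ * r)) with hV
  set c₁ := g₁.coeff w₁ with hc₁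
  set c₂ := g₂.coeff w₂ with hc₂
  have h₁ : c₁ ≠ 0 := hw₁.coeff_ne_zero
  have h₂ : c₂ ≠ 0 := hw₂.coeff_ne_zero
  set L : Poly K n := MonoidAlgebra.single l 1
  set A : Poly K n := MonoidAlgebra.single a 1
  set R : Poly K n := MonoidAlgebra.single r 1
  set W₁ : Poly K n := MonoidAlgebra.single w₁ 1
  set W₂ : Poly K n := MonoidAlgebra.single w₂ 1
  have hX : (L * g₁ * A) * (g₂ - MonoidAlgebra.single w₂ c₂) * R ∈ V := by
    refine mul_mem_of_forall_single fun t ht => ?_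
    have : L * g₁ * A * MonoidAlgebra.single t 1 * R = multiple 1 l g₁ (a * t * r) := by
      have : (MonoidAlgebra.single (a * t * r) 1 : Poly K n) =
          A * MonoidAlgebra.single t 1 * R := by
        simp [A, R, MonoidAlgebra.single_mul_single]
      rw [multiple, this]
      simp only [mul_assoc, L]
    rw [this]
    refine multiple_mem_multiplesSpan hg₁ hw₁ ?_ _
    have := O.mul_lt (l * w₁ * a) r _ _ (hw₂.lt_of_mem_support_sub ht)
    simpa only [mul_assoc] using this
  have hY : L * (g₁ - MonoidAlgebra.single w₁ c₁) * (A * g₂ * R) ∈ V := by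
    refine mul_mem_of_forall_single fun t ht => ?_
    have : L * MonoidAlgebra.single t 1 * (A * g₂ * R) = multiple 1 (l * t * a) g₂ r := by
      have : (MonoidAlgebra.single (l * t * a) 1 : Poly K n) =
          L * MonoidAlgebra.single t 1 * A := by
        simp [A, L, MonoidAlgebra.single_mul_single]
      rw [multiple, this]
      simp only [mul_assoc, R]
    rw [this]
    refine multiple_mem_multiplesSpan hg₂ hw₂ ?_ _
    have := O.mul_lt l (a * w₂ * r) _ _ (hw₁.lt_of_mem_support_sub ht)
    simpa only [mul_assoc] using this
  have hs₁ : (MonoidAlgebra.single w₁ c₁ : Poly K n) = c₁ • W₁ := by simp [W₁]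
  have hs₂ : (MonoidAlgebra.single w₂ c₂ : Poly K n) = c₂ • W₂ := by simp [W₂]
  have e₁ : monicMultiple w₁ l g₁ (a * w₂ * r) = c₁⁻¹ • (L * g₁ * A * W₂ * R) := by
    have : (MonoidAlgebra.single (a * w₂ * r) 1 : Poly K n) = A * W₂ * R := by
      simp [A, R, W₂, MonoidAlgebra.single_mul_single]
    rw [monicMultiple, multiple_eq_smul, multiple, this]
    simp only [mul_assoc, L, hc₁]
  have e₂ : monicMultiple w₂ (l * w₁ * a) g₂ r = c₂⁻¹ • (L * W₁ * A * g₂ * R) := by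
    have : (MonoidAlgebra.single (l * w₁ * a) 1 : Poly K n) = L * W₁ * A := by
      simp [A, L, W₁, MonoidAlgebra.single_mul_single]
    rw [monicMultiple, multiple_eq_smul, multiple, this]
  -- For monic `gᵢ` with lead words `wᵢ`, add and subtract `g₁ a g₂`: `g₁ a w₂ - w₁ a g₂ = (g₁ - w₁)
  -- a g₂ - g₁ a (g₂ - w₂)`. Both products on the right involve a tail, hence only smaller
  -- multiples.
  have key : monicMultiple w₁ l g₁ (a * w₂ * r) - monicMultiple w₂ (l * w₁ * a) g₂ r =
      (c₁⁻¹ * c₂⁻¹) • (L * (g₁ - MonoidAlgebra.single w₁ c₁) * (A * g₂ * R)) -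
      (c₁⁻¹ * c₂⁻¹) • ((L * g₁ * A) * (g₂ - MonoidAlgebra.single w₂ c₂) * R) := by
    rw [e₁, e₂, hs₁, hs₂]
    simp only [mul_sub, sub_mul, mul_smul_comm, smul_mul_assoc, smul_sub, smul_smul, mul_assoc]
    rw [inv_mul_cancel₀ h₂, mul_one, mul_comm c₂⁻¹ c₁, inv_mul_cancel_left₀ h₁]
    abel
  rw [key]
  exact V.sub_mem (V.smul_mem _ hY) (V.smul_mem _ hX)

/-- Up to the scalar `c₁⁻¹ * c₂⁻¹` the difference is an S-polynomial. Its terms at the overlap word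
cancel, so its reduction to zero uses only multiples below that word. -/
theorem monicMultiple_sub_mem_of_isOverlap
    (hS : ∀ p₁ ∈ G, ∀ p₂ ∈ G, ∀ s, IsSPoly O p₁ p₂ s → ReducesTo O G s 0)
    {g₁ g₂ : Poly K n} (hg₁ : g₁ ∈ G) (hg₂ : g₂ ∈ G)
    {w₁ w₂ : Monomial n} (hw₁ : IsLeadMon O g₁ w₁) (hw₂ : IsLeadMon O g₂ w₂)
    {l₁ r₁ l₂ r₂ : Monomial n} (ho : IsOverlap w₁ w₂ l₁ r₁ l₂ r₂) :
    monicMultiple w₁ l₁ g₁ r₁ - monicMultiple w₂ l₂ g₂ r₂ ∈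
      multiplesSpan O G (O.lt · (l₁ * w₁ * r₁)) := by
  set c₁ := g₁.coeff w₁ with hc₁
  set c₂ := g₂.coeff w₂ with hc₂
  have h₁ : c₁ ≠ 0 := hw₁.coeff_ne_zero
  have h₂ : c₂ ≠ 0 := hw₂.coeff_ne_zero
  have hs := hS g₁ hg₁ g₂ hg₂ _ ⟨w₁, w₂, l₁, r₁, l₂, r₂, hw₁, hw₂, ho, rfl⟩
  have hmem := hs.mem_multiplesSpan (P := (O.lt · (l₁ * w₁ * r₁)))
    (fun a b h h' => O.trans _ _ _ h h') ?_
  · have := Submodule.smul_mem _ (c₁⁻¹ * c₂⁻¹) hmem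
    convert this using 1
    rw [monicMultiple, monicMultiple, multiple_eq_smul, multiple_eq_smul _ l₂,
      multiple_eq_smul c₂, multiple_eq_smul c₁, smul_sub, smul_smul, smul_smul, mul_assoc,
      inv_mul_cancel₀ h₂, mul_one, mul_comm c₁⁻¹, mul_assoc, inv_mul_cancel₀ h₁, mul_one]
  · intro m hm
    refine AdmissibleOrder.lt_of_le_of_ne ?_ ?_
    · rcases mem_support_or_of_sub hm with h | h
      · obtain ⟨t, ht, rfl⟩ := exists_of_mem_support_multiple h
        exact AdmissibleOrder.mul_le _ _ (hw₁.le ht)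
      · obtain ⟨t, ht, rfl⟩ := exists_of_mem_support_multiple h
        rw [ho.word_eq]
        exact AdmissibleOrder.mul_le _ _ (hw₂.le ht)
    · rintro rfl
      refine Finsupp.mem_support_iff.1 hm ?_
      change (multiple c₂ l₁ g₁ r₁).coeff (l₁ * w₁ * r₁) -
        (multiple c₁ l₂ g₂ r₂).coeff (l₁ * w₁ * r₁) = 0
      rw [coeff_multiple, ho.word_eq, coeff_multiple, ← hc₁, ← hc₂]
      ring

/-- A polynomial with lead monomial `1` is constant, so its position in a word is irrelevant. This
covers an empty lead word, which shares no letter and hence has no overlaps. -/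
theorem monicMultiple_one_eq {g : Poly K n} (hw : IsLeadMon O g 1) {l r l' r' : Monomial n}
    (h : l * r = l' * r') : monicMultiple 1 l g r = monicMultiple 1 l' g r' := by
  have hg : g = MonoidAlgebra.single 1 (g.coeff 1) := by
    ext m
    by_cases hm : m = 1
    · simp [hm]
    · have : g.coeff m = 0 := by
        by_contra h0
        exact O.irrefl _ (O.trans _ _ _ (O.one_lt m hm)
          (hw.2 m (Finsupp.mem_support_iff.2 h0) hm))
      simp [this, Ne.symm hm]
  rw [hg]
  simp [monicMultiple, multiple, MonoidAlgebra.single_mul_single, h]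

theorem monicMultiple_mul {w l r a b : Monomial n} {g : Poly K n} :
    monicMultiple w (a * l) g (r * b) = multiple 1 a (monicMultiple w l g r) b := by
  rw [monicMultiple, monicMultiple, multiple_multiple, one_mul]

theorem eq_mul_or_eq_mul_of_mul_eq_mul {a b c d : Monomial n} (h : a * b = c * d) :
    (∃ x, c = a * x ∧ b = x * d) ∨ ∃ x, a = c * x ∧ d = x * b :=
  List.append_eq_append_iff.1 h

/-- The occurrence of `w₂` starts no earlier than that of `w₁`. It lies after `w₁`, inside `w₁`, or
straddles the end of `w₁`; the first case is the disjoint one, and the others are overlaps unless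
the shared part is empty. -/
theorem monicMultiple_sub_mem_of_prefix
    (hS : ∀ p₁ ∈ G, ∀ p₂ ∈ G, ∀ s, IsSPoly O p₁ p₂ s → ReducesTo O G s 0)
    {g₁ g₂ : Poly K n} (hg₁ : g₁ ∈ G) (hg₂ : g₂ ∈ G)
    {w₁ w₂ : Monomial n} (hw₁ : IsLeadMon O g₁ w₁) (hw₂ : IsLeadMon O g₂ w₂)
    {l r₁ x r₂ : Monomial n} (h : w₁ * r₁ = x * (w₂ * r₂)) :
    monicMultiple w₁ l g₁ r₁ - monicMultiple w₂ (l * x) g₂ r₂ ∈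
      multiplesSpan O G (O.lt · (l * w₁ * r₁)) := by
  rcases eq_mul_or_eq_mul_of_mul_eq_mul h with ⟨y, rfl, rfl⟩ | ⟨y, rfl, h'⟩
  · have := monicMultiple_sub_mem_of_disjoint hg₁ hg₂ hw₁ hw₂ l y r₂
    simpa only [mul_assoc] using this
  rcases eq_mul_or_eq_mul_of_mul_eq_mul h' with ⟨z, rfl, rfl⟩ | ⟨z, rfl, rfl⟩
  · by_cases hne : w₂ = 1
    · subst hne
      -- Slide the constant `g₂` from inside `w₁` to its right end, where the occurrences are
      -- disjoint.
      have := monicMultiple_sub_mem_of_disjoint hg₁ hg₂ hw₁ hw₂ l 1 r₁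
      rw [monicMultiple_one_eq hw₂ (l' := l * x) (r' := z * r₁) (by simp [mul_assoc])] at this
      simpa only [one_mul, mul_one] using this
    · have hpos : 0 < w₂.length := Nat.pos_of_ne_zero fun h0 =>
        hne (FreeMonoid.length_eq_zero.1 h0)
      have ho : IsOverlap (x * (w₂ * z)) w₂ 1 1 x z :=
        { word_eq := by simp [mul_assoc]
          left_one := Or.inl rfl
          right_one := Or.inl rfl
          shared := ⟨x.length, by simp, by simp; omega, le_rfl, by omega⟩ }
      have := multiple_mem_of_mem_multiplesSpan (Q := (O.lt · (l * (x * (w₂ * z)) * r₁))) l r₁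
        (fun t ht => by simpa using O.mul_lt l r₁ _ _ ht) 1
        (monicMultiple_sub_mem_of_isOverlap hS hg₁ hg₂ hw₁ hw₂ ho)
      rw [multiple_sub, ← monicMultiple_mul, ← monicMultiple_mul] at this
      simpa only [one_mul, mul_one] using this
  · by_cases hne : y = 1
    · subst hne
      have hw₁' : IsLeadMon O g₁ x := by simpa using hw₁
      have hw₂' : IsLeadMon O g₂ z := by simpa using hw₂
      have := monicMultiple_sub_mem_of_disjoint hg₁ hg₂ hw₁' hw₂' l 1 r₂
      simpa only [one_mul, mul_one, mul_assoc] using this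
    · have hpos : 0 < y.length := Nat.pos_of_ne_zero fun h0 =>
        hne (FreeMonoid.length_eq_zero.1 h0)
      have ho : IsOverlap (x * y) (y * z) 1 z x 1 :=
        { word_eq := by simp [mul_assoc]
          left_one := Or.inl rfl
          right_one := Or.inr rfl
          shared := ⟨x.length, by simp, by simp; omega, le_rfl, by simp; omega⟩ }
      have := multiple_mem_of_mem_multiplesSpan (Q := (O.lt · (l * (x * y) * (z * r₂)))) l r₂
        (fun t ht => by simpa only [one_mul, mul_assoc] using O.mul_lt l r₂ _ _ ht) 1
        (monicMultiple_sub_mem_of_isOverlap hS hg₁ hg₂ hw₁ hw₂ ho)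
      rw [multiple_sub, ← monicMultiple_mul, ← monicMultiple_mul] at this
      simpa only [one_mul, mul_one] using this

theorem monicMultiple_sub_mem
    (hS : ∀ p₁ ∈ G, ∀ p₂ ∈ G, ∀ s, IsSPoly O p₁ p₂ s → ReducesTo O G s 0)
    {g₁ g₂ : Poly K n} (hg₁ : g₁ ∈ G) (hg₂ : g₂ ∈ G)
    {w₁ w₂ : Monomial n} (hw₁ : IsLeadMon O g₁ w₁) (hw₂ : IsLeadMon O g₂ w₂)
    {l₁ r₁ l₂ r₂ : Monomial n} (h : l₁ * w₁ * r₁ = l₂ * w₂ * r₂) :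
    monicMultiple w₁ l₁ g₁ r₁ - monicMultiple w₂ l₂ g₂ r₂ ∈
      multiplesSpan O G (O.lt · (l₁ * w₁ * r₁)) := by
  have h' : l₁ * (w₁ * r₁) = l₂ * (w₂ * r₂) := by simpa only [mul_assoc] using h
  rcases eq_mul_or_eq_mul_of_mul_eq_mul h' with ⟨x, rfl, hx⟩ | ⟨x, rfl, hx⟩
  · exact monicMultiple_sub_mem_of_prefix hS hg₁ hg₂ hw₁ hw₂ hx
  · rw [h, ← Submodule.neg_mem_iff, neg_sub]
    exact monicMultiple_sub_mem_of_prefix hS hg₂ hg₁ hw₂ hw₁ hx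

theorem exists_of_mem_multiplesSpan_le {M : Monomial n} {f : Poly K n}
    (hf : f ∈ multiplesSpan O G (O.le · M)) :
    f ∈ multiplesSpan O G (O.lt · M) ∨
      ∃ g ∈ G, ∃ w l r, IsLeadMon O g w ∧ l * w * r = M := by
  by_cases h : ∃ g ∈ G, ∃ w l r, IsLeadMon O g w ∧ l * w * r = M
  · exact Or.inr h
  · left
    refine Submodule.span_mono ?_ hf
    rintro _ ⟨g, hg, w, l, r, hw, hle, rfl⟩
    exact ⟨g, hg, w, l, r, hw, hle.resolve_left fun he => h ⟨g, hg, w, l, r, hw, he⟩, rfl⟩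

theorem coeff_eq_zero_of_mem_multiplesSpan_lt {M : Monomial n} {f : Poly K n}
    (hf : f ∈ multiplesSpan O G (O.lt · M)) : f.coeff M = 0 := by
  by_contra h
  exact O.irrefl _ (forall_support_of_mem_multiplesSpan (fun a b h h' => O.trans _ _ _ h h') hf M
    (Finsupp.mem_support_iff.2 h))

/-- Fix one monic multiple with top word `M`. Subtracting it `f.coeff M` times is linear in `f` and
sends every generator into the span of multiples below `M`; if the coefficient is zero, nothing is
subtracted. -/
theorem mem_multiplesSpan_lt_of_coeff_eq_zero
    (hS : ∀ p₁ ∈ G, ∀ p₂ ∈ G, ∀ s, IsSPoly O p₁ p₂ s → ReducesTo O G s 0)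
    {M : Monomial n} {f : Poly K n} (hf : f ∈ multiplesSpan O G (O.le · M))
    (h0 : f.coeff M = 0) : f ∈ multiplesSpan O G (O.lt · M) := by
  rcases exists_of_mem_multiplesSpan_le hf with h | ⟨g, hg, w, l, r, hw, rfl⟩
  · exact h
  suffices h : f - f.coeff (l * w * r) • monicMultiple w l g r ∈
      multiplesSpan O G (O.lt · (l * w * r)) by
    simpa [h0] using h
  clear h0
  induction hf using Submodule.span_induction with
  | mem x hx =>
    obtain ⟨g', hg', w', l', r', hw', hle, rfl⟩ := hx
    rcases hle with he | hlt
    · have h := Submodule.smul_mem _ (g'.coeff w') (monicMultiple_sub_mem hS hg' hg hw' hw he)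
      rw [he] at h
      have hc : (multiple 1 l' g' r').coeff (l * w * r) = g'.coeff w' := by
        rw [← he, coeff_multiple, one_mul]
      rw [hc]
      convert h using 1
      have : g'.coeff w' • monicMultiple w' l' g' r' = multiple 1 l' g' r' := by
        rw [monicMultiple, multiple_eq_smul (g'.coeff w')⁻¹, smul_smul,
          mul_inv_cancel₀ hw'.coeff_ne_zero, one_smul]
      rw [smul_sub, this]
    · have hmem : multiple 1 l' g' r' ∈ multiplesSpan O G (O.lt · (l * w * r)) :=
        multiple_mem_multiplesSpan hg' hw' hlt 1
      rw [coeff_eq_zero_of_mem_multiplesSpan_lt hmem]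
      simpa using hmem
  | zero => simp
  | add x y _ _ hx hy =>
    convert Submodule.add_mem _ hx hy using 1
    simp only [MonoidAlgebra.coeff_add, Finsupp.add_apply, add_smul]
    abel
  | smul c x _ hx =>
    convert Submodule.smul_mem _ c hx using 1
    simp only [MonoidAlgebra.coeff_smul, Finsupp.smul_apply, smul_sub, smul_smul, smul_eq_mul]

/-- If the S-polynomials of `G` reduce to zero, the lead monomial of every nonzero member of the
ideal generated by `G` is divisible by the lead monomial of a member of `G`. -/
theorem IsGroebnerBasis.exists_isLeadMon_dvd {J : TwoSidedIdeal (Poly K n)}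
    (hG : IsGroebnerBasis O J G) {f : Poly K n} (hf : f ∈ J) {m : Monomial n}
    (hm : IsLeadMon O f m) : ∃ g ∈ G, ∃ w l r, IsLeadMon O g w ∧ l * w * r = m := by
  -- Well-founded descent on the bound: while the coefficient at `M` vanishes, the bound can be
  -- lowered. A bound at which `f` has a nonzero coefficient must be its lead monomial.
  have key : ∀ M, f ∈ multiplesSpan O G (O.le · M) →
      ∃ M, f ∈ multiplesSpan O G (O.le · M) ∧ f.coeff M ≠ 0 := by
    intro M
    induction M using O.wellFounded.induction with
    | _ M ih =>
      intro hM
      by_cases h0 : f.coeff M = 0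
      · rcases eq_zero_or_exists_le_of_mem_multiplesSpan
          (mem_multiplesSpan_lt_of_coeff_eq_zero hG.spoly_reduces hM h0) with h | ⟨M', hlt, hM'⟩
        · exact absurd h hm.ne_zero
        · exact ih M' hlt hM'
      · exact ⟨M, hM, h0⟩
  have hmem : f ∈ multiplesSpan O G (fun _ => True) := by
    rw [← hG.span_eq] at hf
    refine mem_submodule_of_mem_span (fun g hg l r => ?_) hf
    obtain ⟨w, hw⟩ := exists_isLeadMon O (hG.ne_zero g hg)
    exact multiple_mem_multiplesSpan hg hw trivial 1
  obtain ⟨M₀, -, hM₀⟩ :=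
    (eq_zero_or_exists_le_of_mem_multiplesSpan hmem).resolve_left hm.ne_zero
  obtain ⟨M, hM, hne⟩ := key M₀ hM₀
  have hmM : m = M := by
    by_contra h
    have hlt := hm.2 M (Finsupp.mem_support_iff.2 hne) (Ne.symm h)
    have hle := forall_support_of_mem_multiplesSpan (P := (O.le · M))
      (fun a b h h' => Or.inr (AdmissibleOrder.lt_of_lt_of_le h h')) hM m hm.1
    exact O.irrefl _ (AdmissibleOrder.lt_of_le_of_lt hle hlt)
  subst hmM
  exact (exists_of_mem_multiplesSpan_le hM).resolve_left
    fun h => hne (coeff_eq_zero_of_mem_multiplesSpan_lt h)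

/-- Induction along the division of members of `J` by `G`. -/
theorem division_induction {J : TwoSidedIdeal (Poly K n)} (hGJ : ∀ g ∈ G, g ∈ J)
    (hlead : ∀ f ∈ J, ∀ m, IsLeadMon O f m → ∃ g ∈ G, ∃ w l r, IsLeadMon O g w ∧ l * w * r = m)
    {motive : Poly K n → Prop} (zero : motive 0)
    (step : ∀ f g w l r, g ∈ G → IsLeadMon O g w → l * w * r ∈ f.coeff.support →
      motive (f - multiple (f.coeff (l * w * r) * (g.coeff w)⁻¹) l g r) → motive f)
    {f : Poly K n} (hf : f ∈ J) : motive f := by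
  have key : ∀ m, ∀ f ∈ J, IsLeadMon O f m → motive f := by
    intro m
    induction m using O.wellFounded.induction with
    | _ m ih =>
      intro f hf hm
      obtain ⟨g, hg, w, l, r, hw, rfl⟩ := hlead f hf m hm
      refine step f g w l r hg hw hm.1 ?_
      set c := f.coeff (l * w * r) * (g.coeff w)⁻¹ with hc
      by_cases h0 : f - multiple c l g r = 0
      · rwa [h0]
      obtain ⟨m', hm'⟩ := exists_isLeadMon O h0
      -- Always dividing at the lead monomial makes it drop strictly.
      refine ih m' (AdmissibleOrder.lt_of_le_of_ne ?_ ?_) _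
        (J.sub_mem hf (multiple_mem (hGJ g hg) _ _ _)) hm'
      · rcases mem_support_or_of_sub hm'.1 with h | h
        · exact hm.le h
        · obtain ⟨t, ht, rfl⟩ := exists_of_mem_support_multiple h
          exact AdmissibleOrder.mul_le _ _ (hw.le ht)
      · rintro rfl
        apply hm'.coeff_ne_zero
        change f.coeff (l * w * r) - (multiple c l g r).coeff (l * w * r) = 0
        rw [coeff_multiple, hc, inv_mul_cancel_right₀ hw.coeff_ne_zero, sub_self]
  by_cases h0 : f = 0
  · rwa [h0]
  · obtain ⟨m, hm⟩ := exists_isLeadMon O h0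
    exact key m f hf hm

/-- Lead monomial criterion for Gröbner bases. -/
theorem isGroebnerBasis_of_lead {J : TwoSidedIdeal (Poly K n)} (hfin : G.Finite)
    (hne : ∀ g ∈ G, g ≠ 0) (hGJ : ∀ g ∈ G, g ∈ J)
    (hlead : ∀ f ∈ J, ∀ m, IsLeadMon O f m →
      ∃ g ∈ G, ∃ w l r, IsLeadMon O g w ∧ l * w * r = m) : IsGroebnerBasis O J G where
  finite := hfin
  ne_zero := hne
  span_eq := by
    refine le_antisymm (TwoSidedIdeal.span_le.2 hGJ) fun f hf => ?_
    refine division_induction (motive := fun f => f ∈ TwoSidedIdeal.span G) hGJ hlead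
      (zero_mem _) ?_ hf
    intro f g w l r hg _ _ h
    have := add_mem h (multiple_mem (TwoSidedIdeal.subset_span hg)
      (f.coeff (l * w * r) * (g.coeff w)⁻¹) l r)
    rwa [sub_add_cancel] at this
  spoly_reduces := by
    rintro p₁ h₁ p₂ h₂ _ ⟨m₁, m₂, l₁, r₁, l₂, r₂, -, -, -, rfl⟩
    refine division_induction (motive := fun f => ReducesTo O G f 0) hGJ hlead
      Relation.ReflTransGen.refl ?_
      (J.sub_mem (multiple_mem (hGJ _ h₁) _ _ _) (multiple_mem (hGJ _ h₂) _ _ _))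
    exact fun f g w l r hg hw hm h => Relation.ReflTransGen.head ⟨g, hg, w, l, r, hw, hm, rfl⟩ h

end Buchberger

/-! ### Initials, extendibility and the initial ideal -/

section Initials

variable {K : Type*} [Field K] {n : ℕ} {O : AdmissibleOrder n} {θ : OrderingFunction n}

theorem coeff_initial_of_forall_le {p : Poly K n} {m : Monomial n}
    (h : ∀ m' ∈ p.coeff.support, θ m' ≤ θ m) : (initial θ p).coeff m = p.coeff m := by
  classical
  rw [initial, MonoidAlgebra.coeff_ofCoeff]
  exact Finsupp.filter_apply_pos _ _ h

theorem mem_support_initial {p : Poly K n} {m : Monomial n} :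
    m ∈ (initial θ p).coeff.support ↔
      m ∈ p.coeff.support ∧ ∀ m' ∈ p.coeff.support, θ m' ≤ θ m := by
  classical
  simp [initial, Finsupp.support_filter]

theorem isHomogeneous_iff {p : Poly K n} :
    IsHomogeneous θ p ↔ ∀ m ∈ p.coeff.support, ∀ m' ∈ p.coeff.support, θ m' ≤ θ m := by
  constructor
  · intro h m hm
    rw [IsHomogeneous] at h
    rw [h] at hm
    exact (mem_support_initial.1 hm).2
  · intro h
    ext m
    by_cases hm : m ∈ p.coeff.support
    · rw [coeff_initial_of_forall_le (h m hm)]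
    · have : m ∉ (initial θ p).coeff.support := fun h' => hm (mem_support_initial.1 h').1
      rw [Finsupp.notMem_support_iff.1 hm, Finsupp.notMem_support_iff.1 this]

theorem apply_eq_of_mem_support_initial {p : Poly K n} {m m' : Monomial n}
    (hm : m ∈ (initial θ p).coeff.support) (hm' : m' ∈ (initial θ p).coeff.support) :
    θ m = θ m' :=
  le_antisymm ((mem_support_initial.1 hm').2 _ (mem_support_initial.1 hm).1)
    ((mem_support_initial.1 hm).2 _ (mem_support_initial.1 hm').1)

/-- An extendible ordering function respects equality of values under multiplication. -/
theorem IsExtendible.apply_mul_eq (hθ : IsExtendible K θ) (u v : Monomial n) {m₁ m₂ : Monomial n}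
    (h : θ m₁ = θ m₂) : θ (u * m₁ * v) = θ (u * m₂ * v) := by
  by_cases hne : m₁ = m₂
  · rw [hne]
  -- The binomial `m₁ + m₂` is homogeneous exactly because the two values agree, and extendibility
  -- keeps its multiples homogeneous.
  set p : Poly K n := MonoidAlgebra.single m₁ 1 + MonoidAlgebra.single m₂ 1 with hp
  have hp₁ : p.coeff m₁ = 1 := by simp [hp, Ne.symm hne]
  have hp₂ : p.coeff m₂ = 1 := by simp [hp, hne]
  have hsupp : ∀ m ∈ p.coeff.support, θ m = θ m₂ := by
    intro m hm
    have : m = m₁ ∨ m = m₂ := by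
      by_contra! h'
      simp [hp, Ne.symm h'.1, Ne.symm h'.2] at hm
    rcases this with rfl | rfl
    · exact h
    · rfl
  have hhom : IsHomogeneous θ p := isHomogeneous_iff.2 fun m hm m' hm' => by
    rw [hsupp m hm, hsupp m' hm']
  have hmul : IsHomogeneous θ (multiple 1 u p v) := hθ p hhom u v 1 1 one_ne_zero one_ne_zero
  have h₁ : u * m₁ * v ∈ (multiple 1 u p v).coeff.support := by
    rw [Finsupp.mem_support_iff, coeff_multiple, hp₁]; simp
  have h₂ : u * m₂ * v ∈ (multiple 1 u p v).coeff.support := by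
    rw [Finsupp.mem_support_iff, coeff_multiple, hp₂]; simp
  exact le_antisymm (isHomogeneous_iff.1 hmul _ h₂ _ h₁) (isHomogeneous_iff.1 hmul _ h₁ _ h₂)

theorem Defines.apply_le {Θ : ℕ → OrderingFunction n} (h : Defines Θ O) {m₁ m₂ : Monomial n}
    (hm : O.le m₁ m₂) : Θ 0 m₁ ≤ Θ 0 m₂ := by
  rcases hm with rfl | hm
  · exact le_rfl
  obtain ⟨i, hi, hj⟩ := h _ _ hm
  rcases Nat.eq_zero_or_pos i with rfl | hpos
  · exact hi.le
  · exact (hj 0 hpos).le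

theorem lt_of_apply_lt (hmono : ∀ m₁ m₂, O.le m₁ m₂ → θ m₁ ≤ θ m₂) {m₁ m₂ : Monomial n}
    (h : θ m₁ < θ m₂) : O.lt m₁ m₂ :=
  (O.le_total m₂ m₁).resolve_left fun h' => not_le_of_gt h (hmono _ _ h')

/-- If `θ` is weakly monotone for the ordering, `p` and its initial have the same lead term. -/
theorem IsLeadMon.initial (hmono : ∀ m₁ m₂, O.le m₁ m₂ → θ m₁ ≤ θ m₂) {p : Poly K n}
    {m : Monomial n} (h : IsLeadMon O p m) : IsLeadMon O (initial θ p) m :=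
  ⟨mem_support_initial.2 ⟨h.1, fun _ hm' => hmono _ _ (h.le hm')⟩,
    fun m' hm' hne => h.2 m' (mem_support_initial.1 hm').1 hne⟩

theorem initial_ne_zero (O : AdmissibleOrder n) (hmono : ∀ m₁ m₂, O.le m₁ m₂ → θ m₁ ≤ θ m₂)
    {p : Poly K n} (hp : p ≠ 0) : NCWalk.initial θ p ≠ 0 := by
  obtain ⟨m, hm⟩ := exists_isLeadMon O hp
  exact (hm.initial hmono).ne_zero

theorem apply_lt_of_notMem_support_initial {p : Poly K n} {m m' : Monomial n}
    (hm : m ∈ (initial θ p).coeff.support) (h : m' ∈ p.coeff.support)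
    (h' : m' ∉ (initial θ p).coeff.support) : θ m' < θ m := by
  have hm := mem_support_initial.1 hm
  refine lt_of_not_ge fun hle => h' (mem_support_initial.2 ⟨h, fun t ht => ?_⟩)
  exact (hm.2 t ht).trans hle

theorem initial_mem_initialIdeal {J : TwoSidedIdeal (Poly K n)} {p : Poly K n} (hp : p ∈ J) :
    initial θ p ∈ initialIdeal θ J :=
  TwoSidedIdeal.subset_span ⟨p, hp, rfl⟩

/-- The part of a member of `in_θ(J)` of `θ`-value `d` is the part of value `d` of a member of `J`
without terms of larger value. -/
theorem exists_mem_of_mem_initialIdeal (hθ : IsExtendible K θ) (hstrict : PreservesStrict θ)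
    {J : TwoSidedIdeal (Poly K n)} {q : Poly K n} (hq : q ∈ initialIdeal θ J) (d : ℤ) :
    ∃ p ∈ J, (∀ m ∈ p.coeff.support, θ m ≤ d) ∧ ∀ m, θ m = d → p.coeff m = q.coeff m := by
  -- For fixed `d` the admissible `q` form a subspace, so only the multiples `ℓ in_θ(p) r` need
  -- checking. Such a multiple is homogeneous: if its value is `d`, then `ℓ p r` serves as witness
  -- by strictness, otherwise `0` does.
  let V : Submodule K (Poly K n) :=
    { carrier := {q | ∃ p ∈ J, (∀ m ∈ p.coeff.support, θ m ≤ d) ∧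
        ∀ m, θ m = d → p.coeff m = q.coeff m}
      zero_mem' := ⟨0, J.zero_mem, by simp, fun _ _ => rfl⟩
      add_mem' := by
        rintro a b ⟨p, hp, hle, heq⟩ ⟨p', hp', hle', heq'⟩
        refine ⟨p + p', J.add_mem hp hp',
          fun m hm => (mem_support_or_of_add hm).elim (hle m) (hle' m), fun m hm => ?_⟩
        simp [heq m hm, heq' m hm]
      smul_mem' := by
        rintro c a ⟨p, hp, hle, heq⟩
        refine ⟨c • p, ?_, fun m hm => hle m (Finsupp.support_smul hm), fun m hm => ?_⟩
        · have : c • p = multiple c 1 p 1 := by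
            rw [multiple_eq_smul, multiple, ← MonoidAlgebra.one_def, one_mul, mul_one]
          rw [this]
          exact multiple_mem hp _ _ _
        · simp [heq m hm] }
  refine mem_submodule_of_mem_span (V := V) ?_ hq
  rintro _ ⟨p, hp, rfl⟩ l r
  by_cases h : ∃ m ∈ (initial θ p).coeff.support, θ (l * m * r) = d
  · obtain ⟨m, hm, rfl⟩ := h
    refine ⟨multiple 1 l p r, multiple_mem hp _ _ _, fun t ht => ?_, fun t ht => ?_⟩
    · obtain ⟨s, hs, rfl⟩ := exists_of_mem_support_multiple ht
      by_cases hs' : s ∈ (initial θ p).coeff.support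
      · exact (hθ.apply_mul_eq l r (apply_eq_of_mem_support_initial hs' hm)).le
      · exact (hstrict l r _ _ (apply_lt_of_notMem_support_initial hm hs hs')).le
    · by_cases hs : ∃ s, t = l * s * r
      · obtain ⟨s, rfl⟩ := hs
        rw [coeff_multiple, coeff_multiple]
        by_cases hs : s ∈ p.coeff.support
        · by_cases hs' : s ∈ (initial θ p).coeff.support
          · rw [coeff_initial_of_forall_le (mem_support_initial.1 hs').2]
          · exact absurd ht (hstrict l r _ _ (apply_lt_of_notMem_support_initial hm hs hs')).ne
        · have hs' : s ∉ (initial θ p).coeff.support := fun h => hs (mem_support_initial.1 h).1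
          rw [Finsupp.notMem_support_iff.1 hs, Finsupp.notMem_support_iff.1 hs']
      · have h0 : ∀ p : Poly K n, (multiple 1 l p r).coeff t = 0 := fun p => by
          by_contra h
          obtain ⟨s, -, hs'⟩ := exists_of_mem_support_multiple (Finsupp.mem_support_iff.2 h)
          exact hs ⟨s, hs'⟩
        rw [h0, h0]
  · refine ⟨0, J.zero_mem, by simp, fun t ht => ?_⟩
    by_contra h'
    obtain ⟨s, hs, rfl⟩ :=
      exists_of_mem_support_multiple (Finsupp.mem_support_iff.2 (Ne.symm h'))
    exact h ⟨s, hs, ht⟩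

/-- Take `d = θ m`: terms of `p` of lower value are smaller than `m`, and those of value `d` are
terms of `q`. -/
theorem exists_mem_isLeadMon_of_mem_initialIdeal (hθ : IsExtendible K θ)
    (hstrict : PreservesStrict θ) (hmono : ∀ m₁ m₂, O.le m₁ m₂ → θ m₁ ≤ θ m₂)
    {J : TwoSidedIdeal (Poly K n)} {q : Poly K n} (hq : q ∈ initialIdeal θ J) {m : Monomial n}
    (hm : IsLeadMon O q m) : ∃ p ∈ J, IsLeadMon O p m := by
  obtain ⟨p, hp, hle, heq⟩ := exists_mem_of_mem_initialIdeal hθ hstrict hq (θ m)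
  refine ⟨p, hp, ?_, fun t ht hne => ?_⟩
  · rw [Finsupp.mem_support_iff, heq m rfl]
    exact hm.coeff_ne_zero
  · rcases (hle t ht).lt_or_eq with h | h
    · exact lt_of_apply_lt hmono h
    · refine hm.2 t ?_ hne
      rw [Finsupp.mem_support_iff, ← heq t h]
      exact Finsupp.mem_support_iff.1 ht

/-- The initials of a Gröbner basis of `J` form a Gröbner basis of `in_θ(J)`. -/
theorem IsGroebnerBasis.image_initial (hθ : IsExtendible K θ) (hstrict : PreservesStrict θ)
    (hmono : ∀ m₁ m₂, O.le m₁ m₂ → θ m₁ ≤ θ m₂) {J : TwoSidedIdeal (Poly K n)}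
    {G : Set (Poly K n)} (hG : IsGroebnerBasis O J G) :
    IsGroebnerBasis O (initialIdeal θ J) (initial θ '' G) := by
  have hGJ : ∀ g ∈ G, g ∈ J := fun g hg => by
    rw [← hG.span_eq]; exact TwoSidedIdeal.subset_span hg
  refine isGroebnerBasis_of_lead (hG.finite.image _) ?_ ?_ ?_
  · rintro _ ⟨g, hg, rfl⟩
    exact initial_ne_zero O hmono (hG.ne_zero g hg)
  · rintro _ ⟨g, hg, rfl⟩
    exact initial_mem_initialIdeal (hGJ g hg)
  · intro q hq m hm
    obtain ⟨p, hp, hpm⟩ := exists_mem_isLeadMon_of_mem_initialIdeal hθ hstrict hmono hq hm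
    obtain ⟨g, hg, w, l, r, hw, h⟩ := hG.exists_isLeadMon_dvd hp hpm
    exact ⟨_, ⟨g, hg, rfl⟩, w, l, r, hw.initial hmono, h⟩

end Initials

/-! ### Logs and the `θ`-values of their summands -/

section Logs

variable {K : Type*} [Field K] {n : ℕ} {O : AdmissibleOrder n} {θ : OrderingFunction n}
  {G : Set (Poly K n)}

theorem DivisionLog.mem {p : Poly K n} {L : Log K n} (h : DivisionLog O θ G p L) :
    ∀ e ∈ L, e.poly ∈ G := by
  induction h with
  | zero => simp
  | step p g L w l r hg hw hm _ ih =>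
    intro e he
    rcases List.mem_cons.1 he with rfl | he
    · exact hg
    · exact ih e he

theorem DivisionLog.initialSum_eq {p : Poly K n} {L : Log K n} (h : DivisionLog O θ G p L) :
    initialSum θ L = p := by
  induction h with
  | zero => simp [initialSum]
  | step p g L w l r hg hw hm _ ih =>
    rw [initialSum] at ih
    rw [initialSum, List.map_cons, List.sum_cons, ih]
    abel

/-- All members of the ideal of a Gröbner basis of initials can be divided with remainder `0`. -/
theorem IsGroebnerBasis.exists_divisionLog {I : TwoSidedIdeal (Poly K n)}
    (hG : IsGroebnerBasis O I (initial θ '' G)) {p : Poly K n} (hp : p ∈ I) :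
    ∃ L, DivisionLog O θ G p L := by
  refine division_induction (O := O) (G := initial θ '' G)
    (motive := fun p => ∃ L, DivisionLog O θ G p L)
    (fun g hg => by rw [← hG.span_eq]; exact TwoSidedIdeal.subset_span hg)
    (fun f hf m hm => hG.exists_isLeadMon_dvd hf hm) ⟨_, DivisionLog.zero⟩ ?_ hp
  rintro f _ w l r ⟨g, hg, rfl⟩ hw hm ⟨L, hL⟩
  exact ⟨_, DivisionLog.step f g L w l r hg hw hm hL⟩

/-- A division step replaces a monomial by others of the same `θ`-value, since the divisor is
homogeneous. Values thus never rise, even if `p` itself is not homogeneous. -/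
theorem DivisionLog.apply_le (hθ : IsExtendible K θ) {p : Poly K n} {L : Log K n}
    (h : DivisionLog O θ G p L) :
    ∀ e ∈ L, ∀ m ∈ (initial θ e.poly).coeff.support,
      ∃ s ∈ p.coeff.support, θ (e.left * m * e.right) ≤ θ s := by
  induction h with
  | zero => simp
  | step p g L w l r hg hw hm _ ih =>
    intro e he m hme
    rcases List.mem_cons.1 he with rfl | he
    · exact ⟨_, hm, (hθ.apply_mul_eq l r (apply_eq_of_mem_support_initial hme hw.1)).le⟩
    · obtain ⟨s, hs, hle⟩ := ih e he m hme
      rcases mem_support_or_of_sub hs with hs | hs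
      · exact ⟨s, hs, hle⟩
      · obtain ⟨t, ht, rfl⟩ := exists_of_mem_support_multiple hs
        refine ⟨_, hm, hle.trans ?_⟩
        exact (hθ.apply_mul_eq l r (apply_eq_of_mem_support_initial ht hw.1)).le

theorem apply_eq_of_mem_multiple (hθ : IsExtendible K θ) {L : Log K n} {d : ℤ}
    (hL : ∀ e ∈ L, ∀ m ∈ (initial θ e.poly).coeff.support, θ (e.left * m * e.right) = d)
    {w : Monomial n} (hw : θ w = d) (c : K) (l r : Monomial n) :
    ∀ e ∈ Log.multiple c l L r, ∀ m ∈ (initial θ e.poly).coeff.support,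
      θ (e.left * m * e.right) = θ (l * w * r) := by
  intro e he m hm
  obtain ⟨e, he', rfl⟩ := List.mem_map.1 he
  have := hθ.apply_mul_eq l r ((hL e he' m hm).trans hw.symm)
  simpa only [mul_assoc] using this

/-- Logged computations started from initials are homogeneous: the polynomial and all summands of
its log consist of terms of the same `θ`-value. -/
theorem MoraLog.exists_apply_eq (hθ : IsExtendible K θ) {p : Poly K n} {L : Log K n}
    (h : MoraLog O θ G p L) :
    ∃ d, (∀ m ∈ p.coeff.support, θ m = d) ∧
      ∀ e ∈ L, ∀ m ∈ (initial θ e.poly).coeff.support, θ (e.left * m * e.right) = d := by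
  induction h with
  | input g hg =>
    -- Zero is not excluded from `G` here; a zero initial has no terms, so any `d` will do.
    by_cases h0 : (initial θ g).coeff.support.Nonempty
    · obtain ⟨m, hm⟩ := h0
      refine ⟨θ m, fun t ht => apply_eq_of_mem_support_initial ht hm, fun e he t ht => ?_⟩
      rw [List.mem_singleton] at he
      subst he
      simpa using apply_eq_of_mem_support_initial ht hm
    · rw [Finset.not_nonempty_iff_eq_empty] at h0
      refine ⟨0, by simp [h0], fun e he t ht => ?_⟩
      rw [List.mem_singleton] at he
      subst he
      simp [h0] at ht
  | spoly p₁ p₂ L₁ L₂ m₁ m₂ l₁ r₁ l₂ r₂ _ _ hm₁ hm₂ ho ih₁ ih₂ =>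
    obtain ⟨d₁, hp₁, hL₁⟩ := ih₁
    obtain ⟨d₂, hp₂, hL₂⟩ := ih₂
    refine ⟨θ (l₁ * m₁ * r₁), fun m hm => ?_, fun e he => ?_⟩
    · rcases mem_support_or_of_sub hm with h | h
      · obtain ⟨t, ht, rfl⟩ := exists_of_mem_support_multiple h
        exact hθ.apply_mul_eq _ _ ((hp₁ t ht).trans (hp₁ _ hm₁.1).symm)
      · obtain ⟨t, ht, rfl⟩ := exists_of_mem_support_multiple h
        rw [ho.word_eq]
        exact hθ.apply_mul_eq _ _ ((hp₂ t ht).trans (hp₂ _ hm₂.1).symm)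
    · rcases List.mem_append.1 he with he | he
      · exact apply_eq_of_mem_multiple hθ hL₁ (hp₁ _ hm₁.1) _ _ _ e he
      · rw [ho.word_eq]
        exact apply_eq_of_mem_multiple hθ hL₂ (hp₂ _ hm₂.1) _ _ _ e he
  | divide p q L M w l r _ _ hw hm ih₁ ih₂ =>
    obtain ⟨d₁, hp, hL⟩ := ih₁
    obtain ⟨d₂, hq, hM⟩ := ih₂
    refine ⟨d₁, fun m hm' => ?_, fun e he t ht => ?_⟩
    · rcases mem_support_or_of_sub hm' with h | h
      · exact hp m h
      · obtain ⟨t, ht, rfl⟩ := exists_of_mem_support_multiple h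
        rw [← hp _ hm]
        exact hθ.apply_mul_eq _ _ ((hq t ht).trans (hq _ hw.1).symm)
    · rcases List.mem_append.1 he with he | he
      · exact hL e he t ht
      · rw [← hp _ hm]
        exact apply_eq_of_mem_multiple hθ hM (hq _ hw.1) _ _ _ e he t ht
  | normalise p L w _ hw ih =>
    obtain ⟨d, hp, hL⟩ := ih
    refine ⟨d, fun m hm => ?_, fun e he t ht => ?_⟩
    · obtain ⟨t, ht, rfl⟩ := exists_of_mem_support_multiple hm
      simpa using hp t ht
    · rw [apply_eq_of_mem_multiple hθ hL (hp _ hw.1) _ _ _ e he t ht]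
      simpa using hp _ hw.1

theorem liftSum_mem {J : TwoSidedIdeal (Poly K n)} {L : Log K n} (h : ∀ e ∈ L, e.poly ∈ J) :
    liftSum L ∈ J := by
  induction L with
  | nil => exact J.zero_mem
  | cons e L ih =>
    rw [liftSum, List.map_cons, List.sum_cons]
    exact J.add_mem (multiple_mem (h e (by simp)) _ _ _) (ih fun e' he' => h e' (by simp [he']))

/-- Lifting a log whose summands have values at most `d` only adds terms of value less than `d`. -/
theorem apply_lt_of_mem_support_liftSum_sub (hstrict : PreservesStrict θ) {L : Log K n} {d : ℤ}
    (hne : ∀ e ∈ L, (initial θ e.poly).coeff.support.Nonempty)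
    (hL : ∀ e ∈ L, ∀ m ∈ (initial θ e.poly).coeff.support, θ (e.left * m * e.right) ≤ d) :
    ∀ m ∈ (liftSum L - initialSum θ L).coeff.support, θ m < d := by
  induction L with
  | nil => simp [liftSum, initialSum]
  | cons e L ih =>
    have hsplit : liftSum (e :: L) - initialSum θ (e :: L) =
        multiple e.coeff e.left (e.poly - initial θ e.poly) e.right +
          (liftSum L - initialSum θ L) := by
      rw [multiple_sub]
      simp only [liftSum, initialSum, List.map_cons, List.sum_cons]
      abel
    intro m hm
    rw [hsplit] at hm
    rcases mem_support_or_of_add hm with hm | hm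
    · obtain ⟨t, ht, rfl⟩ := exists_of_mem_support_multiple hm
      obtain ⟨s, hs⟩ := hne e (by simp)
      have ht' : t ∉ (initial θ e.poly).coeff.support := fun h => by
        rw [Finsupp.mem_support_iff] at ht
        apply ht
        change e.poly.coeff t - (initial θ e.poly).coeff t = 0
        rw [coeff_initial_of_forall_le (mem_support_initial.1 h).2, sub_self]
      have htp : t ∈ e.poly.coeff.support := (mem_support_or_of_sub ht).resolve_right ht'
      exact (hstrict _ _ _ _ (apply_lt_of_notMem_support_initial hs htp ht')).trans_le
        (hL e (by simp) s hs)
    · exact ih (fun e' he' => hne e' (by simp [he'])) (fun e' he' => hL e' (by simp [he'])) m hm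

end Logs

/-! ### Lifting preserves lead monomials -/

section Lifting

variable {K : Type*} [Field K] {n : ℕ} {O O' : AdmissibleOrder n} {θ : OrderingFunction n}
  {G : Set (Poly K n)}

/-- A polynomial and its lift along a logged representation have the same lead monomial. -/
theorem IsLoggedRepresentation.isLeadMon_liftSum (hθ : IsExtendible K θ)
    (hstrict : PreservesStrict θ) (hmono : ∀ m₁ m₂, O'.le m₁ m₂ → θ m₁ ≤ θ m₂)
    (hG : ∀ g ∈ G, g ≠ 0) {p : Poly K n} {L : Log K n}
    (h : IsLoggedRepresentation O O' θ G p L) {w : Monomial n} (hw : IsLeadMon O' p w) :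
    IsLeadMon O' (liftSum L) w := by
  -- Only an upper bound is needed: Mora logs give equality by homogeneity, and division logs are
  -- bounded by some monomial of `p`, which is at most `w`.
  have hL : ∀ e ∈ L, ∀ m ∈ (initial θ e.poly).coeff.support,
      θ (e.left * m * e.right) ≤ θ w := by
    intro e he m hm
    rcases h.computed with hM | hD | hD
    · obtain ⟨d, hp, hd⟩ := hM.exists_apply_eq hθ
      rw [hd e he m hm, hp w hw.1]
    · obtain ⟨s, hs, hle⟩ := hD.apply_le hθ e he m hm
      exact hle.trans (hmono _ _ (hw.le hs))
    · obtain ⟨s, hs, hle⟩ := hD.apply_le hθ e he m hm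
      exact hle.trans (hmono _ _ (hw.le hs))
  have hne : ∀ e ∈ L, (initial θ e.poly).coeff.support.Nonempty := fun e he => by
    have := initial_ne_zero O' hmono (hG _ (h.mem e he))
    simpa [Finsupp.support_nonempty_iff] using this
  have hlow := apply_lt_of_mem_support_liftSum_sub hstrict hne hL
  rw [h.sum_eq] at hlow
  have hsum : liftSum L = p + (liftSum L - p) := by abel
  constructor
  · rw [Finsupp.mem_support_iff]
    have h0 : (liftSum L - p).coeff w = 0 := by
      by_contra h0
      exact lt_irrefl _ (hlow w (Finsupp.mem_support_iff.2 h0))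
    rw [hsum, MonoidAlgebra.coeff_add, Finsupp.add_apply, h0, add_zero]
    exact hw.coeff_ne_zero
  · intro m hm hne'
    rw [hsum] at hm
    rcases mem_support_or_of_add hm with hm | hm
    · exact hw.2 m hm hne'
    · exact lt_of_apply_lt hmono (hlow m hm)

/-- Lifting a Gröbner basis of the ideal `in_θ(J)` along logged representations yields a Gröbner
basis of `J`. -/
theorem IsGroebnerBasis.image_liftSum (hθ : IsExtendible K θ) (hstrict : PreservesStrict θ)
    (hmono : ∀ m₁ m₂, O'.le m₁ m₂ → θ m₁ ≤ θ m₂) {J : TwoSidedIdeal (Poly K n)}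
    (hG : IsGroebnerBasis O J G) {H' : Set (Poly K n)}
    (hH' : IsGroebnerBasis O' (initialIdeal θ J) H') {log : Poly K n → Log K n}
    (hlog : ∀ h' ∈ H', IsLoggedRepresentation O O' θ G h' (log h')) :
    IsGroebnerBasis O' J ((fun h' => liftSum (log h')) '' H') := by
  have hlead : ∀ h' ∈ H', ∀ w, IsLeadMon O' h' w → IsLeadMon O' (liftSum (log h')) w :=
    fun h' hh' w hw => (hlog h' hh').isLeadMon_liftSum hθ hstrict hmono hG.ne_zero hw
  refine isGroebnerBasis_of_lead (hH'.finite.image _) ?_ ?_ ?_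
  · rintro _ ⟨h', hh', rfl⟩
    obtain ⟨w, hw⟩ := exists_isLeadMon O' (hH'.ne_zero h' hh')
    exact (hlead h' hh' w hw).ne_zero
  · rintro _ ⟨h', hh', rfl⟩
    refine liftSum_mem fun e he => ?_
    rw [← hG.span_eq]
    exact TwoSidedIdeal.subset_span ((hlog h' hh').mem e he)
  · intro f hf m hm
    obtain ⟨h', hh', w, l, r, hw, h⟩ :=
      hH'.exists_isLeadMon_dvd (initial_mem_initialIdeal hf) (hm.initial hmono)
    exact ⟨_, ⟨h', hh', rfl⟩, w, l, r, hlead h' hh' w hw, h⟩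

end Lifting

end NCWalk

theorem mainTheorem12 {K : Type*} [Field K] {n : ℕ} (O O' : NCWalk.AdmissibleOrder n)
    (A B : ℕ → NCWalk.OrderingFunction n) (hAB : NCWalk.AreHarmonious K O O' A B)
    (hstrict : NCWalk.PreservesStrict (A 0))
    (J : TwoSidedIdeal (NCWalk.Poly K n)) (G : Set (NCWalk.Poly K n))
    (hG : NCWalk.IsGroebnerBasis O J G) :
    NCWalk.IsGroebnerBasis O (NCWalk.initialIdeal (A 0) J) (NCWalk.initial (A 0) '' G) ∧
    ∀ H' : Set (NCWalk.Poly K n),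
      NCWalk.IsGroebnerBasis O' (TwoSidedIdeal.span (NCWalk.initial (A 0) '' G)) H' →
      (∀ h' ∈ H', ∃ L, NCWalk.IsLoggedRepresentation O O' (A 0) G h' L) ∧
      ∀ log : NCWalk.Poly K n → NCWalk.Log K n,
        (∀ h' ∈ H', NCWalk.IsLoggedRepresentation O O' (A 0) G h' (log h')) →
        NCWalk.IsGroebnerBasis O' J ((fun h' => NCWalk.liftSum (log h')) '' H') := by
  have hmono : ∀ m₁ m₂, O.le m₁ m₂ → A 0 m₁ ≤ A 0 m₂ := fun _ _ => hAB.defines_left.apply_le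
  have hmono' : ∀ m₁ m₂, O'.le m₁ m₂ → A 0 m₁ ≤ A 0 m₂ := fun _ _ h => by
    rw [hAB.first_eq]
    exact hAB.defines_right.apply_le h
  have hG' := hG.image_initial hAB.extendible hstrict hmono
  refine ⟨hG', fun H' hH' => ?_⟩
  rw [hG'.span_eq] at hH'
  refine ⟨fun h' hh' => ?_, fun log hlog =>
    hG.image_liftSum hAB.extendible hstrict hmono' hH' hlog⟩
  have hmem : h' ∈ NCWalk.initialIdeal (A 0) J := by
    rw [← hH'.span_eq]
    exact TwoSidedIdeal.subset_span hh'
  obtain ⟨L, hL⟩ := hG'.exists_divisionLog hmem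
  -- Division by means of `O` always succeeds, because part (1) makes the initials a Gröbner basis
  -- for `O`.
  exact ⟨L, hL.mem, hL.initialSum_eq, Or.inr (Or.inl hL)⟩
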